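/- Let $\alpha\in(0,2]$ and $|\theta|\le\min(1,2/\alpha-1)$; such pairs $(\alpha,\theta)$ are called admissible. Let $G(\cdot,\alpha,\theta)$ be the distribution function of the standard strictly stable law with parameters $(\alpha,\theta)$ in Zolotarev's parameterization "C", i.e. of the probability measure on $\mathbb R$ with characteristic function $$\int_{\mathbb R} e^{itx}\,dG(x,\alpha,\theta)=\exp\bigl\{-|t|^{\alpha}\exp\{-i\tfrac{\pi}{2}\alpha\theta\,\operatorname{sign}t\}\bigr\},\qquad t\in\mathbb R .$$ For $N\ge 1$ and $x>0$ put $$G_N^{\infty}(x,\alpha,\theta)=\frac1\pi\sum_{n=1}^{N-1}\frac{(-1)^{n+1}}{n!}\,\Gamma(\alpha n)\,\sin\bigl(\tfrac{\pi}{2}\alpha n(1+\theta)\bigr)\,x^{-\alpha n}.$$ Then there are functions $\mathcal R_N^{\infty}(x,\alpha,\theta)$, $N\ge1$, such that for every admissible $(\alpha,\theta)$ with $\theta\ne\pm1$ and every integer $N\ge1$ the following holds. For all real $x\ne0$, with $\theta^*=\theta\,\operatorname{sign}x$, $$G(x,\alpha,\theta)=\tfrac12(1+\operatorname{sign}x)-\operatorname{sign}x\,\bigl(G_N^{\infty}(|x|,\alpha,\theta^*)+\mathcal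 R_N^{\infty}(|x|,\alpha,\theta^*)\bigr),$$ and, as $x\to+\infty$, i.e. for all $x\ge x_0$ with some $x_0=x_0(\alpha,\theta,N)$, $$|\mathcal R_N^{\infty}(x,\alpha,\theta)|\le\frac{x^{-\alpha N}}{\pi N!}\bigl(\Gamma(\alpha N)+x^{-\alpha}\,\Gamma(\alpha(N+1))\bigr).$$ (Since $(\alpha,-\theta)$ is admissible together with $(\alpha,\theta)$, this gives the expansion with its remainder estimate both as $x\to+\infty$ and as $x\to-\infty$.) -/

import Mathlib

open MeasureTheory ProbabilityTheory Filter

noncomputable section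

/-- The set of admissible parameters `(α, θ)` of strictly stable laws in Zolotarev's
parameterization "C": `0 < α ≤ 2` and `|θ| ≤ min (1, 2/α - 1)`. -/
def StableAdmissible (α θ : ℝ) : Prop :=
  0 < α ∧ α ≤ 2 ∧ |θ| ≤ min 1 (2 / α - 1)

/-- The characteristic function of the standard strictly stable law (scale parameter `1`) in the
parameterization "C": `t ↦ exp (-|t|^α exp (-i (π/2) α θ sign t))`. -/
def stableCharFun (t α θ : ℝ) : ℂ :=
  Complex.exp (-((|t| ^ α : ℝ) : ℂ) *
    Complex.exp (-Complex.I * ((Real.pi / 2 * α * θ * Real.sign t : ℝ) : ℂ)))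

/-- `μ` is the standard strictly stable law with parameters `(α, θ)`: the probability measure on
the real line whose characteristic function `t ↦ ∫ exp (i t x) dμ(x)` is `stableCharFun · α θ`. -/
structure IsStandardStrictlyStable (μ : Measure ℝ) (α θ : ℝ) : Prop where
  isProbabilityMeasure : IsProbabilityMeasure μ
  charFun_eq : ∀ t : ℝ, charFun μ t = stableCharFun t α θ

/-- The partial sum
`(1/π) ∑_{n=1}^{N-1} (-1)^(n+1)/n! · Γ(α n) · sin ((π/2) α n (1+θ)) · x^(-α n)`, for `x > 0`. -/
def stableCdfPartialSum (N : ℕ) (x α θ : ℝ) : ℝ :=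
  1 / Real.pi * ∑ n ∈ Finset.Ico 1 N,
    (-1 : ℝ) ^ (n + 1) / (n.factorial : ℝ) * Real.Gamma (α * n) *
      Real.sin (Real.pi / 2 * α * n * (1 + θ)) * x ^ (-(α * n))

/-- The bound `x^(-α N) / (π N!) · (Γ(α N) + x^(-α) Γ(α (N+1)))` for the remainder, for `x > 0`. -/
def stableCdfRemainderBound (N : ℕ) (x α : ℝ) : ℝ :=
  x ^ (-(α * N)) / (Real.pi * (N.factorial : ℝ)) *
    (Real.Gamma (α * N) + x ^ (-α) * Real.Gamma (α * (N + 1)))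

end

/-! Take the remainder to be the tail integral of the stable density minus the partial sum. The
representation of the distribution function is then Fourier inversion together with the reflection
`θ ↦ -θ` for negative `x`, and the substance is the estimate of the remainder.

Admissibility and `θ ≠ ±1` give `|α θ| < 1`, so the characteristic function decays like `exp (-κ
t^α)` with `κ = cos (π α θ / 2) > 0`, and the density is `(1/π) Re ∫_0^∞ exp (-i x t) ψ(t) dt`. Turn
the ray of integration to argument `-φ`, with `φ > 0` so small that `w = t^α exp (-i π α θ / 2)`
keeps a positive real part. On the new ray `exp (-i x t)` itself decays exponentially, so `ψ = exp
(-w)` may be replaced by its Taylor polynomial: the powers of `w` give Gamma integrals, and the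
remainder `O(|w|^M)` gives `O(x^(-α M - 1))` (`exists_abs_stableDensity_sub_le`). The substitution
`t = e^z` makes the rotation a shift of a horizontal line for an entire function
(`integral_horizontal_line_eq`).

Integration over `(x, ∞)` expands the tail with an unspecified constant in the error. The explicit
bound follows by expanding two terms further: term `N + 1` uses only the fraction `1/(N+1)` of the
second summand of the bound, and the rest absorbs the error for large `x`. -/

open Set Topology

/-! ### Fourier inversion by Abel summation -/

section Inversion

variable (μ : Measure ℝ) [IsProbabilityMeasure μ]

/-- The damping `exp (-ε t)` makes the double integral absolutely convergent, so Fubini applies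
whether or not `charFun μ` is integrable. -/
lemma integral_exp_neg_mul_charFun {ε : ℝ} (hε : 0 < ε) (x : ℝ) :
    ∫ t in Ioi (0 : ℝ), Complex.exp (-((ε + x * Complex.I) * t)) * charFun μ t =
      ∫ y, 1 / ((ε : ℂ) + ((x - y : ℝ) : ℂ) * Complex.I) ∂μ := by
  have hint : Integrable (Function.uncurry fun (t y : ℝ) =>
      Complex.exp (-((ε + x * Complex.I) * t)) * Complex.exp (t * y * Complex.I))
      ((volume.restrict (Ioi 0)).prod μ) := by
    have h1 : Integrable (fun z : ℝ × ℝ => Real.exp (-ε * z.1) * (1 : ℝ))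
        ((volume.restrict (Ioi 0)).prod μ) :=
      (exp_neg_integrableOn_Ioi 0 hε).mul_prod (integrable_const (1 : ℝ))
    refine h1.mono' (by fun_prop) (Eventually.of_forall fun z => ?_)
    simp [Function.uncurry, Complex.norm_exp]
  simp_rw [charFun_apply_real, ← integral_const_mul]
  rw [integral_integral_swap hint]
  refine integral_congr_ae (Eventually.of_forall fun y => ?_)
  simp only [← Complex.exp_add]
  have h := integral_exp_mul_complex_Ioi (a := -((ε : ℂ) + ((x - y : ℝ) : ℂ) * Complex.I))
    (by simpa using hε) 0
  convert h using 1
  · congr 1; ext t; congr 1; push_cast; ring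
  · rw [← neg_div_neg_eq]
    simp

lemma re_one_div_add_mul_I (ε s : ℝ) :
    (1 / ((ε : ℂ) + (s : ℂ) * Complex.I)).re = ε / (ε ^ 2 + s ^ 2) := by
  rw [one_div, Complex.inv_re]
  simp [Complex.normSq_apply, sq]

lemma norm_one_div_add_mul_I_le {ε : ℝ} (hε : 0 < ε) (s : ℝ) :
    ‖1 / ((ε : ℂ) + (s : ℂ) * Complex.I)‖ ≤ 1 / ε := by
  rw [norm_div, norm_one]
  refine one_div_le_one_div_of_le hε ?_
  have := Complex.abs_re_le_norm ((ε : ℂ) + (s : ℂ) * Complex.I)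
  simpa [abs_of_pos hε] using this

lemma re_integral_exp_neg_mul_charFun {ε : ℝ} (hε : 0 < ε) (x : ℝ) :
    (∫ t in Ioi (0 : ℝ), Complex.exp (-((ε + x * Complex.I) * t)) * charFun μ t).re =
      ∫ y, ε / (ε ^ 2 + (x - y) ^ 2) ∂μ := by
  have hi : Integrable (fun y : ℝ => 1 / ((ε : ℂ) + ((x - y : ℝ) : ℂ) * Complex.I)) μ := by
    refine Integrable.of_bound (Measurable.aestronglyMeasurable (by fun_prop)) (1 / ε)
      (Eventually.of_forall fun y => norm_one_div_add_mul_I_le hε _)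
  rw [integral_exp_neg_mul_charFun μ hε]
  refine (integral_re hi).symm.trans (integral_congr_ae (Eventually.of_forall fun y => ?_))
  exact re_one_div_add_mul_I ε (x - y)

lemma integral_poisson_kernel {ε : ℝ} (hε : 0 < ε) (y a b : ℝ) :
    ∫ x in a..b, ε / (ε ^ 2 + (x - y) ^ 2) =
      Real.arctan ((b - y) / ε) - Real.arctan ((a - y) / ε) := by
  refine intervalIntegral.integral_eq_sub_of_hasDerivAt
    (f := fun x => Real.arctan ((x - y) / ε)) (fun x _ => ?_) ?_
  · have h := ((((hasDerivAt_id x).sub_const y).div_const ε)).arctan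
    refine h.congr_deriv ?_
    simp only [id_eq, one_div]
    field_simp
  · refine (Continuous.div continuous_const (by fun_prop) fun x => ?_).intervalIntegrable _ _
    positivity

/-- The real part of the damped integral is `μ` smoothed by the Poisson kernel, whose primitive is
an arctangent. As `ε → 0+` the right-hand integrand tends to `π` times the indicator of `(a, b)`, up
to the endpoints. -/
lemma integral_re_integral_exp_neg_mul_charFun {ε : ℝ} (hε : 0 < ε) (a b : ℝ) :
    ∫ x in a..b,
      (∫ t in Ioi (0 : ℝ), Complex.exp (-((ε + x * Complex.I) * t)) * charFun μ t).re =
      ∫ y, (Real.arctan ((b - y) / ε) - Real.arctan ((a - y) / ε)) ∂μ := by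
  simp_rw [re_integral_exp_neg_mul_charFun μ hε, ← integral_poisson_kernel hε]
  apply intervalIntegral_integral_swap
  have hc : Continuous (Function.uncurry fun x y : ℝ => ε / (ε ^ 2 + (x - y) ^ 2)) := by
    refine Continuous.div continuous_const (by fun_prop) fun x => ?_
    positivity
  have : IsFiniteMeasure ((volume : Measure ℝ).restrict (uIoc a b)) :=
    ⟨by simp [uIoc]⟩
  refine Integrable.of_bound hc.aestronglyMeasurable (1 / ε) (Eventually.of_forall fun z => ?_)
  simp only [Function.uncurry]
  rw [Real.norm_of_nonneg (by positivity), div_le_div_iff₀ (by positivity) hε]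
  nlinarith [sq_nonneg (z.1 - z.2)]

lemma tendsto_arctan_div_nhdsGT_zero (s : ℝ) :
    Tendsto (fun ε : ℝ => Real.arctan (s / ε)) (𝓝[>] 0) (𝓝 (Real.pi / 2 * Real.sign s)) := by
  rcases lt_trichotomy s 0 with hs | rfl | hs
  · rw [Real.sign_of_neg hs, mul_neg_one]
    exact (tendsto_nhds_of_tendsto_nhdsWithin Real.tendsto_arctan_atBot).comp
      ((tendsto_inv_nhdsGT_zero.const_mul_atTop_of_neg hs).congr fun ε => (div_eq_mul_inv s ε).symm)
  · simp
  · rw [Real.sign_of_pos hs, mul_one]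
    exact (tendsto_nhds_of_tendsto_nhdsWithin Real.tendsto_arctan_atTop).comp
      ((tendsto_inv_nhdsGT_zero.const_mul_atTop hs).congr fun ε => (div_eq_mul_inv s ε).symm)

/-- The density attached by Fourier inversion to a function that is the restriction to the positive
half-line of a characteristic function. -/
noncomputable def inversionDensity (ψ : ℝ → ℂ) (x : ℝ) : ℝ :=
  1 / Real.pi * (∫ t in Ioi (0 : ℝ), Complex.exp (-(x * Complex.I * t)) * ψ t).re

lemma norm_exp_neg_mul_mul_le {ε : ℝ} (hε : 0 ≤ ε) (x : ℝ) (z : ℂ) {t : ℝ} (ht : 0 < t) :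
    ‖Complex.exp (-((ε + x * Complex.I) * t)) * z‖ ≤ ‖z‖ := by
  rw [norm_mul, Complex.norm_exp]
  refine mul_le_of_le_one_left (norm_nonneg _) (Real.exp_le_one_iff.2 ?_)
  simp
  positivity

lemma abs_inversionDensity_le (ψ : ℝ → ℂ) (x : ℝ) :
    |inversionDensity ψ x| ≤ 1 / Real.pi * ∫ t in Ioi (0 : ℝ), ‖ψ t‖ := by
  rw [inversionDensity, abs_mul, abs_of_pos (by positivity : 0 < 1 / Real.pi)]
  gcongr
  refine (Complex.abs_re_le_norm _).trans ((norm_integral_le_integral_norm _).trans_eq ?_)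
  congr 1; ext t
  simp [Complex.norm_exp]

lemma continuous_inversionDensity {ψ : ℝ → ℂ} (hψ : IntegrableOn ψ (Ioi 0)) :
    Continuous (inversionDensity ψ) := by
  refine continuous_const.mul (Complex.continuous_re.comp ?_)
  refine continuous_of_dominated (bound := fun t => ‖ψ t‖) (fun x => ?_) (fun x => ?_) hψ.norm
    (Eventually.of_forall fun t => by fun_prop)
  · exact (by fun_prop : Continuous fun t : ℝ =>
      Complex.exp (-(x * Complex.I * t))).aestronglyMeasurable.mul hψ.aestronglyMeasurable
  · exact Eventually.of_forall fun t => by simp [Complex.norm_exp]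

/-- Let `ε → 0+` in the smoothed identity; the dominating functions are built from `‖charFun μ‖` on
one side and the constant `π` on the other. The half difference of signs counts the endpoints with
weight `1/2`, since atoms are not yet excluded. -/
lemma integral_sign_eq_integral_inversionDensity (hψ : IntegrableOn (charFun μ) (Ioi 0))
    (a b : ℝ) :
    ∫ y, (Real.sign (b - y) - Real.sign (a - y)) / 2 ∂μ =
      ∫ x in a..b, inversionDensity (charFun μ) x := by
  set J : ℝ → ℝ → ℂ := fun ε x =>
    ∫ t in Ioi (0 : ℝ), Complex.exp (-((ε + x * Complex.I) * t)) * charFun μ t with hJ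
  have hmeas : ∀ ε x : ℝ, AEStronglyMeasurable (fun t : ℝ =>
      Complex.exp (-((ε + x * Complex.I) * t)) * charFun μ t) (volume.restrict (Ioi 0)) :=
    fun ε x => (by fun_prop : Continuous fun t : ℝ =>
      Complex.exp (-((ε + x * Complex.I) * t))).aestronglyMeasurable.mul hψ.aestronglyMeasurable
  have hbound : ∀ ε x : ℝ, 0 ≤ ε → ∀ᵐ t : ℝ ∂(volume.restrict (Ioi (0 : ℝ))),
      ‖Complex.exp (-((ε + x * Complex.I) * t)) * charFun μ t‖ ≤ ‖charFun μ t‖ :=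
    fun ε x hε => (ae_restrict_iff' measurableSet_Ioi).2
      (Eventually.of_forall fun t ht => norm_exp_neg_mul_mul_le hε x _ ht)
  have hJlim : ∀ x : ℝ, Tendsto (fun ε => J ε x) (𝓝[>] 0) (𝓝 (J 0 x)) := fun x => by
    refine tendsto_integral_filter_of_dominated_convergence (fun t : ℝ => ‖charFun μ t‖)
      (Eventually.of_forall fun ε => hmeas ε x) ?_ hψ.norm (Eventually.of_forall fun (t : ℝ) => ?_)
    · filter_upwards [self_mem_nhdsWithin] with ε hε using hbound ε x (le_of_lt hε)
    · have hc : Continuous fun ε : ℝ =>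
          Complex.exp (-((ε + x * Complex.I) * (t : ℂ))) * charFun μ t := by fun_prop
      exact (hc.tendsto 0).mono_left nhdsWithin_le_nhds
  have hJbound : ∀ ε x : ℝ, 0 ≤ ε → ‖(J ε x).re‖ ≤ ∫ t in Ioi (0 : ℝ), ‖charFun μ t‖ :=
    fun ε x hε => (Complex.abs_re_le_norm _).trans
      (norm_integral_le_of_norm_le hψ.norm (hbound ε x hε))
  have hJcont : ∀ ε : ℝ, 0 ≤ ε → Continuous (J ε) := fun ε hε =>
    continuous_of_dominated (hmeas ε) (fun x => hbound ε x hε) hψ.norm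
      (Eventually.of_forall fun t => by fun_prop)
  have hleft : Tendsto (fun ε => ∫ x in a..b, (J ε x).re) (𝓝[>] 0)
      (𝓝 (∫ x in a..b, (J 0 x).re)) := by
    refine intervalIntegral.tendsto_integral_filter_of_dominated_convergence
      (fun _ => ∫ t in Ioi (0 : ℝ), ‖charFun μ t‖) ?_ ?_ intervalIntegrable_const ?_
    · filter_upwards [self_mem_nhdsWithin] with ε hε using
        (Complex.continuous_re.comp (hJcont ε (le_of_lt hε))).aestronglyMeasurable
    · filter_upwards [self_mem_nhdsWithin] with ε hε using
        Eventually.of_forall fun x _ => hJbound ε x (le_of_lt hε)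
    · exact Eventually.of_forall fun x _ => (Complex.continuous_re.tendsto _).comp (hJlim x)
  have hright : Tendsto
      (fun ε => ∫ y, (Real.arctan ((b - y) / ε) - Real.arctan ((a - y) / ε)) ∂μ) (𝓝[>] 0)
      (𝓝 (∫ y, (Real.pi / 2 * Real.sign (b - y) - Real.pi / 2 * Real.sign (a - y)) ∂μ)) := by
    refine tendsto_integral_filter_of_dominated_convergence (fun _ => Real.pi)
      (Eventually.of_forall fun ε => ?_) (Eventually.of_forall fun ε =>
        Eventually.of_forall fun y => ?_) (integrable_const _) (Eventually.of_forall fun y =>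
          (tendsto_arctan_div_nhdsGT_zero _).sub (tendsto_arctan_div_nhdsGT_zero _))
    · exact Measurable.aestronglyMeasurable (by fun_prop)
    · rw [Real.norm_eq_abs, abs_le]
      constructor <;> linarith [Real.arctan_lt_pi_div_two ((b - y) / ε),
        Real.neg_pi_div_two_lt_arctan ((b - y) / ε), Real.arctan_lt_pi_div_two ((a - y) / ε),
        Real.neg_pi_div_two_lt_arctan ((a - y) / ε)]
  have heq := tendsto_nhds_unique (hleft.congr' (by
    filter_upwards [self_mem_nhdsWithin] with ε hε using
      integral_re_integral_exp_neg_mul_charFun μ hε a b)) hright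
  have hpi := Real.pi_pos.ne'
  simp only [inversionDensity, intervalIntegral.integral_const_mul]
  simp only [hJ, Complex.ofReal_zero, zero_add] at heq
  rw [heq, ← integral_const_mul]
  congr 1; ext y; field_simp

lemma measurable_real_sign : Measurable Real.sign := by
  unfold Real.sign
  exact Measurable.ite measurableSet_Iio measurable_const
    (Measurable.ite measurableSet_Ioi measurable_const measurable_const)

lemma abs_real_sign_le_one (s : ℝ) : |Real.sign s| ≤ 1 := by
  rcases Real.sign_apply_eq s with h | h | h <;> simp [h]

lemma integrable_sign_sub (a b : ℝ) :
    Integrable (fun y => (Real.sign (b - y) - Real.sign (a - y)) / 2) μ := by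
  refine Integrable.of_bound (C := 1) (Measurable.aestronglyMeasurable ?_)
    (Eventually.of_forall fun y => ?_)
  · exact ((measurable_real_sign.comp (measurable_const.sub measurable_id)).sub
      (measurable_real_sign.comp (measurable_const.sub measurable_id))).div_const 2
  · have h1 := abs_le.1 (abs_real_sign_le_one (b - y))
    have h2 := abs_le.1 (abs_real_sign_le_one (a - y))
    rw [Real.norm_eq_abs, abs_le]
    constructor <;> linarith [h1.1, h1.2, h2.1, h2.2]

/-- The interval of radius `δ` about `c` carries at most `2 δ` times the uniform bound `K` of the
inversion density; let `δ → 0`. -/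
lemma measureReal_singleton_eq_zero_of_integrableOn_charFun
    (hψ : IntegrableOn (charFun μ) (Ioi 0)) (c : ℝ) : μ.real {c} = 0 := by
  set K := 1 / Real.pi * ∫ t in Ioi (0 : ℝ), ‖charFun μ t‖ with hK
  have key : ∀ δ : ℝ, 0 < δ → μ.real {c} ≤ K * (2 * δ) := fun δ hδ => by
    have h1 : μ.real {c} ≤
        ∫ y, (Real.sign (c + δ - y) - Real.sign (c - δ - y)) / 2 ∂μ := by
      rw [← integral_indicator_one (measurableSet_singleton c)]
      refine integral_mono ((integrable_const (1 : ℝ)).indicator (measurableSet_singleton c))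
        (integrable_sign_sub μ _ _) fun y => ?_
      by_cases hy : y = c
      · subst hy
        simp [Real.sign_of_pos hδ, Real.sign_of_neg (neg_lt_zero.2 hδ)]
      · simp only [indicator, mem_singleton_iff, hy, if_false]
        rcases lt_trichotomy (c + δ - y) 0 with h | h | h
        · rw [Real.sign_of_neg h, Real.sign_of_neg (by linarith)]; simp
        · rw [h, Real.sign_of_neg (by linarith : c - δ - y < 0)]; norm_num
        · rw [Real.sign_of_pos h]
          have := (abs_le.1 (abs_real_sign_le_one (c - δ - y))).2
          linarith
    rw [integral_sign_eq_integral_inversionDensity μ hψ] at h1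
    refine h1.trans ((le_abs_self _).trans ?_)
    have := intervalIntegral.norm_integral_le_of_norm_le_const (a := c - δ) (b := c + δ)
      (f := inversionDensity (charFun μ)) (C := K)
      fun x _ => abs_inversionDensity_le (charFun μ) x
    rw [show c + δ - (c - δ) = 2 * δ by ring, abs_of_pos (by linarith : 0 < 2 * δ)] at this
    exact this
  have hlim : Tendsto (fun δ : ℝ => K * (2 * δ)) (𝓝[>] 0) (𝓝 0) := by
    have : Continuous fun δ : ℝ => K * (2 * δ) := by fun_prop
    simpa using (this.tendsto 0).mono_left nhdsWithin_le_nhds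
  refine le_antisymm (ge_of_tendsto hlim ?_) measureReal_nonneg
  filter_upwards [self_mem_nhdsWithin] with δ hδ using key δ hδ

/-- **Fourier inversion** for a probability measure with integrable characteristic function. -/
theorem measureReal_Ioc_eq_integral_inversionDensity (hψ : IntegrableOn (charFun μ) (Ioi 0))
    {a b : ℝ} (hab : a ≤ b) :
    μ.real (Ioc a b) = ∫ x in a..b, inversionDensity (charFun μ) x := by
  rw [← integral_sign_eq_integral_inversionDensity μ hψ, ← integral_indicator_one measurableSet_Ioc]
  have hz : ∀ c : ℝ, ∀ᵐ y ∂μ, y ≠ c := fun c => by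
    have := measureReal_singleton_eq_zero_of_integrableOn_charFun μ hψ c
    rw [measureReal_eq_zero_iff] at this
    simpa [ae_iff] using this
  refine integral_congr_ae ?_
  filter_upwards [hz a, hz b] with y ha hb
  by_cases h : y ∈ Ioc a b
  · have h2 : y < b := lt_of_le_of_ne h.2 hb
    rw [indicator_of_mem h, Real.sign_of_pos (by linarith), Real.sign_of_neg (by linarith [h.1])]
    norm_num
  · rw [indicator_of_notMem h]
    rcases lt_or_gt_of_ne ha with h1 | h1
    · rw [Real.sign_of_pos (by linarith), Real.sign_of_pos (by linarith)]; simp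
    · have h2 : b < y := by
        by_contra h3
        exact h ⟨h1, not_lt.1 h3⟩
      rw [Real.sign_of_neg (by linarith), Real.sign_of_neg (by linarith)]; simp

end Inversion

/-! ### Logarithmic coordinates -/

section ExponentialSubstitution

variable {E : Type*} [NormedAddCommGroup E] [NormedSpace ℝ E]

/-- With `t = e^u` rays in the `t`-plane become horizontal lines and `t^α` becomes the entire
function `exp (α z)`, so no branch of the power is needed. -/
lemma integral_exp_smul_comp_exp (g : ℝ → E) :
    ∫ u : ℝ, Real.exp u • g (Real.exp u) = ∫ t in Ioi (0 : ℝ), g t := by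
  have h := integral_image_eq_integral_abs_deriv_smul (s := univ) (f := Real.exp) MeasurableSet.univ
    (fun x _ => (Real.hasDerivAt_exp x).hasDerivWithinAt) Real.exp_injective.injOn g
  rw [image_univ, Real.range_exp] at h
  simpa using h.symm

lemma integrable_exp_smul_comp_exp_iff (g : ℝ → E) :
    Integrable (fun u : ℝ => Real.exp u • g (Real.exp u)) ↔ IntegrableOn g (Ioi 0) := by
  have h := integrableOn_image_iff_integrableOn_abs_deriv_smul (s := univ) (f := Real.exp)
    MeasurableSet.univ (fun x _ => (Real.hasDerivAt_exp x).hasDerivWithinAt)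
    Real.exp_injective.injOn g
  rw [image_univ, Real.range_exp] at h
  simpa using h.symm

variable {a κ β : ℝ}

lemma exp_smul_rpow_mul_exp_neg (u : ℝ) :
    Real.exp u • (Real.exp u ^ (a - 1) * Real.exp (-κ * Real.exp u ^ β)) =
      Real.exp (a * u - κ * Real.exp (β * u)) := by
  rw [← Real.exp_mul, ← Real.exp_mul, smul_eq_mul, ← Real.exp_add, ← Real.exp_add]
  ring_nf

/-- These are the majorants for the contour shifts: `β = α` when the decay comes from the stable
factor, `β = 1` when it comes from `exp (-i x t)` on a turned ray. -/
lemma integrable_exp_mul_sub_mul_exp (ha : 0 < a) (hκ : 0 < κ) (hβ : 0 < β) :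
    Integrable fun u : ℝ => Real.exp (a * u - κ * Real.exp (β * u)) := by
  have h := (integrable_exp_smul_comp_exp_iff _).2
    (integrableOn_rpow_mul_exp_neg_mul_rpow (s := a - 1) (by linarith) hβ hκ)
  simpa only [exp_smul_rpow_mul_exp_neg] using h

lemma integral_exp_mul_sub_mul_exp (ha : 0 < a) (hκ : 0 < κ) :
    ∫ u : ℝ, Real.exp (a * u - κ * Real.exp u) = κ ^ (-a) * Real.Gamma a := by
  have h := integral_exp_smul_comp_exp
    fun t : ℝ => t ^ (a - 1) * Real.exp (-κ * t ^ (1 : ℝ))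
  simp only [exp_smul_rpow_mul_exp_neg] at h
  simp only [one_mul, Real.rpow_one, neg_mul] at h
  rw [h, Real.integral_rpow_mul_exp_neg_mul_Ioi ha hκ, one_div, Real.inv_rpow hκ.le,
    Real.rpow_neg hκ.le]

lemma tendsto_exp_mul_sub_mul_exp_atTop (hκ : 0 < κ) (hβ : 0 < β) :
    Tendsto (fun u : ℝ => Real.exp (a * u - κ * Real.exp (β * u))) atTop (𝓝 0) := by
  have h := (tendsto_rpow_mul_exp_neg_mul_atTop_nhds_zero (a / β) κ hκ).comp
    (Real.tendsto_exp_atTop.comp (tendsto_id.const_mul_atTop hβ))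
  refine h.congr fun u => ?_
  simp only [Function.comp, id, ← Real.exp_mul, ← Real.exp_add]
  congr 1
  field_simp
  ring

lemma tendsto_exp_mul_sub_mul_exp_atBot (ha : 0 < a) (hκ : 0 < κ) :
    Tendsto (fun u : ℝ => Real.exp (a * u - κ * Real.exp (β * u))) atBot (𝓝 0) := by
  refine squeeze_zero (fun u => (Real.exp_pos _).le) (fun u => ?_)
    (Real.tendsto_exp_atBot.comp (tendsto_id.const_mul_atBot ha))
  simp only [Function.comp, id]
  gcongr
  linarith [mul_pos hκ (Real.exp_pos (β * u))]

end ExponentialSubstitution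

/-! ### Shifting a horizontal contour -/

section StripShift

/-- The integrals of an entire function along two horizontal lines agree if the function is
dominated, on the strip between them, by an integrable function of the real part that vanishes
at infinity. -/
theorem integral_horizontal_line_eq {f : ℂ → ℂ} (hf : Differentiable ℂ f) {g : ℝ → ℝ}
    (hg : Integrable g) (htop : Tendsto g atTop (𝓝 0)) (hbot : Tendsto g atBot (𝓝 0)) {b₁ b₂ : ℝ}
    (hfg : ∀ u : ℝ, ∀ v ∈ uIcc b₁ b₂, ‖f (u + v * Complex.I)‖ ≤ g u) :
    ∫ u : ℝ, f (u + b₁ * Complex.I) = ∫ u : ℝ, f (u + b₂ * Complex.I) := by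
  have hint : ∀ v ∈ uIcc b₁ b₂, Integrable fun u : ℝ => f (u + v * Complex.I) := fun v hv =>
    hg.mono' (hf.continuous.comp (by fun_prop)).aestronglyMeasurable
      (Eventually.of_forall fun u => hfg u v hv)
  have hvert : ∀ l : Filter ℝ, Tendsto g l (𝓝 0) →
      Tendsto (fun T : ℝ => ∫ v : ℝ in b₁..b₂, f (T + v * Complex.I)) l (𝓝 0) := fun l hl => by
    refine squeeze_zero_norm (a := fun T => g T * |b₂ - b₁|) (fun T => ?_) (by
      simpa using hl.mul_const |b₂ - b₁|)
    exact intervalIntegral.norm_integral_le_of_norm_le_const fun v hv =>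
      hfg T v (uIoc_subset_uIcc hv)
  -- Cauchy's theorem on the rectangle over `[-T, T]`; the vertical sides vanish as `T → ∞` by
  -- `hvert`.
  have hrect : ∀ T : ℝ, (∫ u in (-T)..T, f (u + b₁ * Complex.I)) -
      (∫ u in (-T)..T, f (u + b₂ * Complex.I)) =
      Complex.I • (∫ v in b₁..b₂, f ((-T : ℝ) + v * Complex.I)) -
      Complex.I • (∫ v in b₁..b₂, f (T + v * Complex.I)) := fun T => by
    have h := Complex.integral_boundary_rect_eq_zero_of_differentiableOn f
      (⟨-T, b₁⟩ : ℂ) (⟨T, b₂⟩ : ℂ) hf.differentiableOn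
    simp only at h
    linear_combination h
  have hlim := ((intervalIntegral_tendsto_integral (hint b₁ left_mem_uIcc)
    tendsto_neg_atTop_atBot tendsto_id).sub (intervalIntegral_tendsto_integral
      (hint b₂ right_mem_uIcc) tendsto_neg_atTop_atBot tendsto_id))
  have hlim0 := ((hvert _ hbot).comp tendsto_neg_atTop_atBot).const_smul Complex.I |>.sub
    ((hvert _ htop).const_smul Complex.I)
  simp only [smul_zero, sub_zero] at hlim0
  refine sub_eq_zero.1 (tendsto_nhds_unique hlim (hlim0.congr fun T => ?_))
  simpa using (hrect T).symm

end StripShift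

/-! ### Taylor remainder of the exponential in a half-plane -/

section ExpTaylor

/-- The Taylor remainder of `exp` at a point of the closed left half-plane. -/
lemma exists_norm_exp_neg_sub_sum_le (M : ℕ) :
    ∃ C : ℝ, 0 ≤ C ∧ ∀ w : ℂ, 0 ≤ w.re →
      ‖Complex.exp (-w) - ∑ n ∈ Finset.range M, (-w) ^ n / (n.factorial : ℂ)‖ ≤ C * ‖w‖ ^ M := by
  -- `e` serves `‖w‖ ≤ 1`. For `‖w‖ ≥ 1` the exponential and each of the `M` Taylor terms are at
  -- most `‖w‖ ^ M`, whence `1 + M`.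
  refine ⟨max (Real.exp 1) (1 + M), by positivity, fun w hw => ?_⟩
  rcases le_total ‖w‖ 1 with h | h
  · have h1 := Complex.norm_exp_sub_sum_le_norm_mul_exp (-w) M
    rw [norm_neg] at h1
    refine h1.trans ?_
    rw [mul_comm]
    gcongr
    exact (Real.exp_le_exp.2 h).trans (le_max_left _ _)
  · have h1 : ‖Complex.exp (-w)‖ ≤ ‖w‖ ^ M := by
      rw [Complex.norm_exp]
      exact (Real.exp_le_one_iff.2 (by simpa using hw)).trans (one_le_pow₀ h)
    have h2 : ‖∑ n ∈ Finset.range M, (-w) ^ n / (n.factorial : ℂ)‖ ≤ M * ‖w‖ ^ M := by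
      rw [← nsmul_eq_mul, ← Finset.card_range M, ← Finset.sum_const, Finset.card_range]
      refine norm_sum_le_of_le _ fun n hn => ?_
      rw [norm_div, norm_pow, norm_neg, Complex.norm_natCast]
      refine (div_le_self (by positivity) ?_).trans
        (pow_le_pow_right₀ h (Finset.mem_range.1 hn).le)
      exact_mod_cast n.factorial_pos
    calc _ ≤ ‖w‖ ^ M + M * ‖w‖ ^ M := (norm_sub_le _ _).trans (add_le_add h1 h2)
      _ = (1 + M) * ‖w‖ ^ M := by ring
      _ ≤ _ := by gcongr; exact le_max_right _ _

end ExpTaylor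

/-! ### Gamma integrals along a turned ray -/

section LaplaceKernel

lemma re_mul_I_mul_exp (x u v : ℝ) :
    (x * Complex.I * Complex.exp (u + v * Complex.I)).re = -(x * Real.sin v * Real.exp u) := by
  have h : Complex.exp (u + v * Complex.I) =
      (Real.exp u : ℂ) * ((Real.cos v : ℂ) + (Real.sin v : ℂ) * Complex.I) := by
    rw [Complex.exp_add, Complex.exp_mul_I, Complex.ofReal_exp, Complex.ofReal_cos,
      Complex.ofReal_sin]
  rw [h]
  simp only [Complex.mul_re, Complex.mul_im, Complex.add_re, Complex.add_im, Complex.ofReal_re,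
    Complex.ofReal_im, Complex.I_re, Complex.I_im]
  ring

lemma norm_exp_mul_sub_mul_I_mul_exp (a x u v : ℝ) :
    ‖Complex.exp (a * (u + v * Complex.I) - x * Complex.I * Complex.exp (u + v * Complex.I))‖ =
      Real.exp (a * u + x * Real.sin v * Real.exp u) := by
  rw [Complex.norm_exp, Complex.sub_re, re_mul_I_mul_exp]
  simp

variable {a x φ : ℝ}

/-- The integral of `s ^ (a - 1) * exp (-i x s)` along the ray of argument `-φ`, in logarithmic
coordinates. -/
lemma integral_exp_mul_sub_mul_I_mul_exp (ha : 0 < a) (hx : 0 < x) (hφ : 0 < φ)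
    (hφ' : φ ≤ Real.pi / 2) :
    ∫ u : ℝ, Complex.exp (a * (u + (-φ : ℝ) * Complex.I) -
        x * Complex.I * Complex.exp (u + (-φ : ℝ) * Complex.I)) =
      Complex.exp (-(Real.pi / 2 * a : ℝ) * Complex.I) * (x ^ (-a) * Real.Gamma a : ℝ) := by
  have hsin : 0 < Real.sin φ := Real.sin_pos_of_pos_of_lt_pi hφ (by linarith [Real.pi_pos])
  have hκ : 0 < x * Real.sin φ := mul_pos hx hsin
  -- Shift to the line `Im z = -π/2`, where `-i x e^z = -x e^u` and the integral is a real Gamma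
  -- integral times a phase. In between `sin v ≤ -sin φ`, which gives the majorant.
  rw [integral_horizontal_line_eq (f := fun z => Complex.exp (a * z -
    x * Complex.I * Complex.exp z)) (by fun_prop)
    (g := fun u => Real.exp (a * u - x * Real.sin φ * Real.exp (1 * u)))
    (integrable_exp_mul_sub_mul_exp ha hκ one_pos)
    (tendsto_exp_mul_sub_mul_exp_atTop hκ one_pos) (tendsto_exp_mul_sub_mul_exp_atBot ha hκ)
    (b₂ := -(Real.pi / 2))]
  · rw [← integral_exp_mul_sub_mul_exp ha hx, ← integral_complex_ofReal, ← integral_const_mul]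
    congr 1; ext u
    have h : Complex.exp (u + (-(Real.pi / 2) : ℝ) * Complex.I) = -(Real.exp u * Complex.I) := by
      rw [Complex.exp_add, ← Complex.ofReal_exp]
      push_cast
      rw [neg_mul, Complex.exp_neg, Complex.exp_pi_div_two_mul_I, Complex.inv_I]
      ring
    rw [h, Complex.ofReal_exp, Complex.ofReal_exp, ← Complex.exp_add]
    congr 1
    push_cast
    linear_combination (x : ℂ) * Complex.exp u * Complex.I_sq
  · intro u v hv
    rw [norm_exp_mul_sub_mul_I_mul_exp, one_mul]
    rw [uIcc_of_ge (by linarith)] at hv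
    have : Real.sin v ≤ -Real.sin φ := by
      rw [← Real.sin_neg]
      exact Real.sin_le_sin_of_le_of_le_pi_div_two hv.1 (by linarith) hv.2
    gcongr
    have := mul_le_mul_of_nonneg_left this (mul_pos hx (Real.exp_pos u)).le
    linarith

end LaplaceKernel

/-! ### The stable density and its expansion -/

section StableDensity

variable {α θ : ℝ}

/-- For `α ≤ 1` this comes from `|θ| < 1`; for `α > 1` from `α |θ| ≤ 2 - α < 1`. -/
lemma StableAdmissible.abs_mul_lt_one (h : StableAdmissible α θ) (h1 : θ ≠ 1) (h2 : θ ≠ -1) :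
    |α * θ| < 1 := by
  obtain ⟨h0, -, h4⟩ := h
  have h5 : |θ| ≤ 1 := h4.trans (min_le_left _ _)
  have h6 : α * |θ| ≤ 2 - α := by
    have := mul_le_mul_of_nonneg_left (h4.trans (min_le_right _ _)) h0.le
    rwa [mul_sub, mul_div_cancel₀ _ h0.ne', mul_one] at this
  have h7 : |θ| < 1 := lt_of_le_of_ne h5 fun h => by
    rcases (abs_eq zero_le_one).1 h with h | h
    · exact h1 h
    · exact h2 h
  rw [abs_mul, abs_of_pos h0]
  rcases le_or_gt α 1 with h8 | h8
  · nlinarith [abs_nonneg θ]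
  · linarith

lemma stableCharFun_of_pos {t : ℝ} (ht : 0 < t) :
    stableCharFun t α θ = Complex.exp (-(((t ^ α : ℝ) : ℂ) *
      Complex.exp ((-(Real.pi / 2 * α * θ) : ℝ) * Complex.I))) := by
  rw [stableCharFun, abs_of_pos ht, Real.sign_of_pos ht]
  congr 1
  rw [neg_mul]
  congr 3
  push_cast
  ring

lemma cos_pos_of_abs_mul_lt_one (h : |α * θ| < 1) : 0 < Real.cos (Real.pi / 2 * α * θ) := by
  have h' := abs_lt.1 h
  refine Real.cos_pos_of_mem_Ioo ⟨?_, ?_⟩ <;> nlinarith [Real.pi_pos, h'.1, h'.2]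

lemma norm_stableCharFun_of_pos {t : ℝ} (ht : 0 < t) :
    ‖stableCharFun t α θ‖ = t ^ (0 : ℝ) *
      Real.exp (-Real.cos (Real.pi / 2 * α * θ) * t ^ α) := by
  rw [stableCharFun_of_pos ht, Complex.norm_exp, Real.rpow_zero, one_mul]
  congr 1
  rw [Complex.neg_re, Complex.re_ofReal_mul, Complex.exp_ofReal_mul_I_re, Real.cos_neg]
  ring

lemma integrableOn_stableCharFun (hα : 0 < α) (h : |α * θ| < 1) :
    IntegrableOn (fun t => stableCharFun t α θ) (Ioi 0) := by
  have hi := integrableOn_rpow_mul_exp_neg_mul_rpow (s := 0) (by norm_num) hα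
    (cos_pos_of_abs_mul_lt_one h)
  refine Integrable.mono' hi ?_ ((ae_restrict_iff' measurableSet_Ioi).2
    (Eventually.of_forall fun t ht => (norm_stableCharFun_of_pos ht).le))
  have hc : Continuous fun t : ℝ => Complex.exp (-(((t ^ α : ℝ) : ℂ) *
      Complex.exp ((-(Real.pi / 2 * α * θ) : ℝ) * Complex.I))) := by
    have := Real.continuous_rpow_const hα.le
    fun_prop
  refine hc.aestronglyMeasurable.congr ((ae_restrict_iff' measurableSet_Ioi).2
    (Eventually.of_forall fun t ht => (stableCharFun_of_pos ht).symm))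

/-- The density of the standard strictly stable law with parameters `(α, θ)`. -/
noncomputable def stableDensity (x α θ : ℝ) : ℝ :=
  inversionDensity (fun t => stableCharFun t α θ) x

lemma stableDensity_neg (x : ℝ) : stableDensity (-x) α θ = stableDensity x α (-θ) := by
  simp only [stableDensity, inversionDensity]
  congr 1
  rw [← Complex.conj_re, ← integral_conj]
  congr 1
  refine setIntegral_congr_fun measurableSet_Ioi fun t ht => ?_
  simp only [stableCharFun_of_pos (mem_Ioi.1 ht), map_mul, ← Complex.exp_conj, map_neg,
    Complex.conj_ofReal, Complex.conj_I]
  push_cast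
  simp only [mul_neg, neg_mul, neg_neg]

/-- The integrand of `stableDensity` in logarithmic coordinates, extended to an entire function. -/
noncomputable def stableKernel (α θ x : ℝ) (z : ℂ) : ℂ :=
  Complex.exp (z - x * Complex.I * Complex.exp z -
    Complex.exp (α * z + (-(Real.pi / 2 * α * θ) : ℝ) * Complex.I))

lemma stableDensity_eq_integral_stableKernel (x : ℝ) :
    stableDensity x α θ = 1 / Real.pi * (∫ u : ℝ, stableKernel α θ x u).re := by
  rw [stableDensity, inversionDensity, ← integral_exp_smul_comp_exp]
  congr 3; ext u
  rw [stableCharFun_of_pos (Real.exp_pos u), ← Real.exp_mul, stableKernel, Complex.real_smul,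
    Complex.ofReal_exp, Complex.ofReal_exp, ← Complex.exp_add, ← Complex.exp_add, ← Complex.exp_add]
  congr 1
  push_cast
  ring_nf

lemma norm_stableKernel (x u v : ℝ) :
    ‖stableKernel α θ x (u + v * Complex.I)‖ = Real.exp (u + x * Real.sin v * Real.exp u -
      Real.cos (α * v - Real.pi / 2 * α * θ) * Real.exp (α * u)) := by
  rw [stableKernel, Complex.norm_exp, Complex.sub_re, Complex.sub_re, re_mul_I_mul_exp]
  have h : (α : ℂ) * (u + v * Complex.I) + (-(Real.pi / 2 * α * θ) : ℝ) * Complex.I =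
      (α * u : ℝ) + (α * v - Real.pi / 2 * α * θ : ℝ) * Complex.I := by push_cast; ring
  rw [h, Complex.exp_add, ← Complex.ofReal_exp, Complex.re_ofReal_mul,
    Complex.exp_ofReal_mul_I_re]
  simp
  ring

lemma exists_angle (hα : 0 < α) (h : |α * θ| < 1) :
    ∃ φ κ : ℝ, 0 < φ ∧ φ ≤ Real.pi / 2 ∧ 0 < κ ∧
      ∀ v ∈ Icc (-φ) 0, κ ≤ Real.cos (α * v - Real.pi / 2 * α * θ) := by
  have hpi := Real.pi_pos
  have h0 := abs_nonneg (α * θ)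
  set m := Real.pi / 4 * (1 + |α * θ|) with hm
  -- The argument starts at most `(π/2)|α θ|` from `0`, and turning moves it by at most `α φ ≤
  -- (π/4)(1 - |α θ|)`, half the room left before `π/2`; the sum is at most `m < π/2`. The
  -- denominator `α + 1` also keeps `φ ≤ π/2`.
  refine ⟨Real.pi / 4 * (1 - |α * θ|) / (α + 1), Real.cos m, ?_, ?_, ?_, fun v hv => ?_⟩
  · have : 0 < 1 - |α * θ| := by linarith
    positivity
  · rw [div_le_iff₀ (by linarith)]
    nlinarith
  · refine Real.cos_pos_of_mem_Ioo ⟨?_, ?_⟩ <;> nlinarith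
  · rw [← Real.cos_abs (α * v - Real.pi / 2 * α * θ)]
    have hmpi : m ≤ Real.pi := by nlinarith
    refine Real.cos_le_cos_of_nonneg_of_le_pi (abs_nonneg _) hmpi ?_
    have h1 : α * |v| ≤ Real.pi / 4 * (1 - |α * θ|) := by
      rw [abs_of_nonpos hv.2]
      have h2 : -v ≤ Real.pi / 4 * (1 - |α * θ|) / (α + 1) := by linarith [hv.1]
      rw [le_div_iff₀ (by linarith)] at h2
      nlinarith [hv.2]
    calc |α * v - Real.pi / 2 * α * θ| ≤ |α * v| + |Real.pi / 2 * α * θ| := abs_sub _ _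
      _ = α * |v| + Real.pi / 2 * |α * θ| := by
        rw [mul_assoc, abs_mul, abs_of_pos hα, abs_mul (Real.pi / 2),
          abs_of_pos (half_pos hpi)]
      _ ≤ m := by rw [hm]; linarith

/-- The coefficients of the expansion of the stable density at `+∞`. -/
noncomputable def stableDensityCoeff (α θ : ℝ) (n : ℕ) : ℝ :=
  1 / Real.pi * ((-1) ^ (n + 1) / (n.factorial : ℝ) * Real.Gamma (α * n + 1) *
    Real.sin (Real.pi / 2 * α * n * (1 + θ)))

/-- The phases of `c^n` and of the Gamma integral add up to `-(A + π/2)` with `A = (π/2) α n (1 +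
θ)`, and `cos (A + π/2) = -sin A` produces the sign `(-1)^(n+1)`. -/
lemma re_stableDensityCoeff (x : ℝ) (n : ℕ) :
    1 / Real.pi * ((-Complex.exp ((-(Real.pi / 2 * α * θ) : ℝ) * Complex.I)) ^ n /
      (n.factorial : ℂ) * (Complex.exp (-(Real.pi / 2 * (α * n + 1) : ℝ) * Complex.I) *
        (x ^ (-(α * n + 1)) * Real.Gamma (α * n + 1) : ℝ))).re =
      stableDensityCoeff α θ n * x ^ (-(α * n + 1)) := by
  have h : (-Complex.exp ((-(Real.pi / 2 * α * θ) : ℝ) * Complex.I)) ^ n / (n.factorial : ℂ) *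
      (Complex.exp (-(Real.pi / 2 * (α * n + 1) : ℝ) * Complex.I) *
        (x ^ (-(α * n + 1)) * Real.Gamma (α * n + 1) : ℝ)) =
      ((-1) ^ n / (n.factorial : ℝ) * (x ^ (-(α * n + 1)) * Real.Gamma (α * n + 1)) : ℝ) *
        Complex.exp ((-(Real.pi / 2 * α * n * (1 + θ) + Real.pi / 2) : ℝ) * Complex.I) := by
    rw [neg_pow, ← Complex.exp_nat_mul, show ((-(Real.pi / 2 * α * n * (1 + θ) + Real.pi / 2) : ℝ) *
      Complex.I : ℂ) = n * ((-(Real.pi / 2 * α * θ) : ℝ) * Complex.I) +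
        -(Real.pi / 2 * (α * n + 1) : ℝ) * Complex.I by push_cast; ring, Complex.exp_add]
    push_cast
    ring
  rw [h, Complex.re_ofReal_mul, Complex.exp_ofReal_mul_I_re, Real.cos_neg,
    Real.cos_add_pi_div_two, stableDensityCoeff, pow_succ]
  ring

/-- The asymptotic expansion of the stable density at `+∞`. -/
theorem exists_abs_stableDensity_sub_le (hα : 0 < α) (h : |α * θ| < 1) (M : ℕ) :
    ∃ C : ℝ, 0 ≤ C ∧ ∀ x : ℝ, 0 < x →
      |stableDensity x α θ - ∑ n ∈ Finset.range M, stableDensityCoeff α θ n * x ^ (-(α * n + 1))| ≤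
        C * x ^ (-(α * M + 1)) := by
  obtain ⟨φ, κ, hφ, hφ', hκ, hcos⟩ := exists_angle hα h
  obtain ⟨C, hC, hexp⟩ := exists_norm_exp_neg_sub_sum_le M
  have hsinφ : 0 < Real.sin φ := Real.sin_pos_of_pos_of_lt_pi hφ (by linarith [Real.pi_pos])
  refine ⟨1 / Real.pi * (C * (Real.sin φ ^ (-(α * M + 1)) * Real.Gamma (α * M + 1))),
    by have := Real.Gamma_nonneg_of_nonneg (by positivity : 0 ≤ α * M + 1); positivity,
    fun x hx => ?_⟩
  have hxs : 0 < x * Real.sin φ := mul_pos hx hsinφ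
  set z : ℝ → ℂ := fun u => u + (-φ : ℝ) * Complex.I with hz
  set c : ℂ := Complex.exp ((-(Real.pi / 2 * α * θ) : ℝ) * Complex.I) with hc
  -- During the shift only the stable factor supplies decay: the `x`-factor has modulus at most `1`,
  -- with equality on the real line.
  have hnorm : ∀ u : ℝ, ∀ v ∈ uIcc 0 (-φ), ‖stableKernel α θ x (u + v * Complex.I)‖ ≤
      Real.exp (1 * u - κ * Real.exp (α * u)) := fun u v hv => by
    rw [uIcc_of_ge (by linarith)] at hv
    rw [norm_stableKernel, one_mul]
    have h1 : Real.sin v ≤ 0 :=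
      Real.sin_nonpos_of_nonpos_of_neg_pi_le hv.2 (by linarith [hv.1, Real.pi_pos])
    have h2 : x * Real.sin v * Real.exp u ≤ 0 :=
      mul_nonpos_of_nonpos_of_nonneg (mul_nonpos_of_nonneg_of_nonpos hx.le h1) (Real.exp_pos u).le
    have h3 := mul_le_mul_of_nonneg_right (hcos v hv) (Real.exp_pos (α * u)).le
    refine Real.exp_le_exp.2 (by linarith)
  have hkint : Integrable fun u : ℝ => Real.exp (1 * u - κ * Real.exp (α * u)) :=
    integrable_exp_mul_sub_mul_exp one_pos hκ hα
  have hkdiff : Differentiable ℂ (stableKernel α θ x) := by unfold stableKernel; fun_prop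
  have hshift : ∫ u : ℝ, stableKernel α θ x u = ∫ u : ℝ, stableKernel α θ x (z u) := by
    have := integral_horizontal_line_eq hkdiff hkint (tendsto_exp_mul_sub_mul_exp_atTop hκ hα)
      (tendsto_exp_mul_sub_mul_exp_atBot one_pos hκ) hnorm
    simpa [hz] using this
  have hzcont : Continuous z := by fun_prop
  have hint : Integrable fun u : ℝ => stableKernel α θ x (z u) :=
    hkint.mono' (hkdiff.continuous.comp hzcont).aestronglyMeasurable
      (Eventually.of_forall fun u => hnorm u (-φ) right_mem_uIcc)
  set T : ℕ → ℝ → ℂ := fun n u => (-c) ^ n / (n.factorial : ℂ) *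
    Complex.exp ((α * n + 1 : ℝ) * z u - x * Complex.I * Complex.exp (z u)) with hT
  have hTnorm : ∀ (a : ℝ) (u : ℝ),
      ‖Complex.exp (a * z u - x * Complex.I * Complex.exp (z u))‖ =
        Real.exp (a * u - x * Real.sin φ * Real.exp (1 * u)) := fun a u => by
    rw [norm_exp_mul_sub_mul_I_mul_exp, Real.sin_neg, one_mul]
    congr 1; ring
  have hTint : ∀ n, Integrable (T n) := fun n => by
    refine Integrable.const_mul ?_ _
    refine (integrable_exp_mul_sub_mul_exp (a := α * n + 1) (by positivity) hxs one_pos).mono'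
      ?_ (Eventually.of_forall fun u => (hTnorm _ u).le)
    exact Continuous.aestronglyMeasurable (by fun_prop)
  have hTval : ∀ n, ∫ u, T n u = (-c) ^ n / (n.factorial : ℂ) *
      (Complex.exp (-(Real.pi / 2 * (α * n + 1) : ℝ) * Complex.I) *
        (x ^ (-(α * n + 1)) * Real.Gamma (α * n + 1) : ℝ)) := fun n => by
    rw [integral_const_mul, integral_exp_mul_sub_mul_I_mul_exp (by positivity) hx hφ hφ']
  -- After the shift the roles change: `Re w ≥ 0` yields the Taylor bound, and the decay `exp (-x
  -- sin φ e^u)` makes it integrable and produces the power of `x`.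
  have hrem : ∀ u : ℝ, ‖stableKernel α θ x (z u) - ∑ n ∈ Finset.range M, T n u‖ ≤
      C * Real.exp ((α * M + 1) * u - x * Real.sin φ * Real.exp (1 * u)) := fun u => by
    set w : ℂ := Complex.exp (α * z u) * c with hw
    have hw_eq : w = (Real.exp (α * u) : ℂ) *
        Complex.exp ((α * (-φ) - Real.pi / 2 * α * θ : ℝ) * Complex.I) := by
      rw [hw, hc, hz, Complex.ofReal_exp, ← Complex.exp_add, ← Complex.exp_add]
      congr 1; push_cast; ring
    have hwre : 0 ≤ w.re := by
      rw [hw_eq, Complex.re_ofReal_mul, Complex.exp_ofReal_mul_I_re]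
      exact mul_nonneg (Real.exp_pos _).le
        (hκ.le.trans (hcos (-φ) ⟨le_rfl, by linarith⟩))
    have hwnorm : ‖w‖ = Real.exp (α * u) := by
      rw [hw_eq, norm_mul, Complex.norm_exp_ofReal_mul_I, mul_one, Complex.norm_real,
        Real.norm_of_nonneg (Real.exp_pos _).le]
    have hfac : stableKernel α θ x (z u) - ∑ n ∈ Finset.range M, T n u =
        Complex.exp ((1 : ℝ) * z u - x * Complex.I * Complex.exp (z u)) *
          (Complex.exp (-w) - ∑ n ∈ Finset.range M, (-w) ^ n / (n.factorial : ℂ)) := by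
      rw [mul_sub, Finset.mul_sum]
      congr 1
      · rw [stableKernel, ← Complex.exp_add, hw, hc, ← Complex.exp_add, Complex.ofReal_one, one_mul]
        ring_nf
      · refine Finset.sum_congr rfl fun n _ => ?_
        have : Complex.exp ((α * n + 1 : ℝ) * z u - x * Complex.I * Complex.exp (z u)) =
            Complex.exp ((1 : ℝ) * z u - x * Complex.I * Complex.exp (z u)) *
              Complex.exp (α * z u) ^ n := by
          rw [← Complex.exp_nat_mul, ← Complex.exp_add]
          congr 1; push_cast; ring
        simp only [hT]
        rw [this, hw, ← mul_neg, mul_pow]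
        ring
    rw [hfac, norm_mul, hTnorm]
    calc _ ≤ Real.exp (1 * u - x * Real.sin φ * Real.exp (1 * u)) * (C * ‖w‖ ^ M) := by
          gcongr; exact hexp w hwre
      _ = _ := by
          rw [hwnorm, ← Real.exp_nat_mul, mul_left_comm, ← Real.exp_add]
          congr 2; ring
  have hmain : ‖∫ u : ℝ, stableKernel α θ x (z u) - ∑ n ∈ Finset.range M, T n u‖ ≤
      C * ((x * Real.sin φ) ^ (-(α * M + 1)) * Real.Gamma (α * M + 1)) := by
    have hpos : 0 < α * M + 1 := by positivity
    refine (norm_integral_le_of_norm_le ((integrable_exp_mul_sub_mul_exp hpos hxs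
      one_pos).const_mul C) (Eventually.of_forall hrem)).trans_eq ?_
    rw [integral_const_mul]
    simp only [one_mul]
    rw [integral_exp_mul_sub_mul_exp hpos hxs]
  rw [integral_sub hint (integrable_finsetSum _ fun n _ => hTint n),
    integral_finsetSum _ fun n _ => hTint n, ← hshift] at hmain
  have hsum : ∑ n ∈ Finset.range M, stableDensityCoeff α θ n * x ^ (-(α * n + 1)) =
      1 / Real.pi * (∑ n ∈ Finset.range M, ∫ u, T n u).re := by
    rw [Complex.re_sum, Finset.mul_sum]
    refine Finset.sum_congr rfl fun n _ => ?_
    rw [hTval, hc, re_stableDensityCoeff]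
  rw [stableDensity_eq_integral_stableKernel, hsum, ← mul_sub, ← Complex.sub_re, abs_mul,
    abs_of_pos (by positivity : 0 < 1 / Real.pi), mul_assoc]
  refine mul_le_mul_of_nonneg_left ?_ (by positivity)
  refine (Complex.abs_re_le_norm _).trans (hmain.trans_eq ?_)
  rw [Real.mul_rpow hx.le hsinφ.le]
  ring

end StableDensity

/-! ### The tail, its expansion and the distribution function -/

section StableTail

variable {α θ : ℝ}

/-- The tail `∫_x^∞` of the stable density. -/
noncomputable def stableTail (x α θ : ℝ) : ℝ :=
  ∫ y in Ioi x, stableDensity y α θ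

lemma continuous_stableDensity (hα : 0 < α) (h : |α * θ| < 1) :
    Continuous fun x => stableDensity x α θ :=
  continuous_inversionDensity (integrableOn_stableCharFun hα h)

/-- Essential for the tail: the term `n = 0` would be a multiple of `x⁻¹`, which is not integrable
at infinity. -/
lemma stableDensityCoeff_zero : stableDensityCoeff α θ 0 = 0 := by
  simp [stableDensityCoeff]

lemma integrableOn_rpow_neg_mul_add_one {x : ℝ} (hα : 0 < α) (hx : 0 < x) {n : ℕ} (hn : 1 ≤ n) :
    IntegrableOn (fun y : ℝ => y ^ (-(α * n + 1))) (Ioi x) := by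
  have : 0 < α * n := mul_pos hα (by exact_mod_cast hn)
  exact integrableOn_Ioi_rpow_of_lt (by linarith) hx

lemma integral_rpow_neg_mul_add_one {x : ℝ} (hα : 0 < α) (hx : 0 < x) {n : ℕ} (hn : 1 ≤ n) :
    ∫ y in Ioi x, y ^ (-(α * n + 1)) = x ^ (-(α * n)) / (α * n) := by
  have : 0 < α * n := mul_pos hα (by exact_mod_cast hn)
  rw [integral_Ioi_rpow_of_lt (by linarith) hx, show -(α * n + 1) + 1 = -(α * n) by ring,
    neg_div_neg_eq]

lemma integrableOn_stableDensity (hα : 0 < α) (h : |α * θ| < 1) {x : ℝ} (hx : 0 < x) :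
    IntegrableOn (fun y => stableDensity y α θ) (Ioi x) := by
  -- At order `1` the sum is only the vanishing zeroth term, so the density is `O(y^(-α-1))`.
  obtain ⟨C, -, hC⟩ := exists_abs_stableDensity_sub_le hα h 1
  refine ((integrableOn_rpow_neg_mul_add_one hα hx le_rfl).const_mul C).mono'
    (continuous_stableDensity hα h).aestronglyMeasurable
    ((ae_restrict_iff' measurableSet_Ioi).2 (Eventually.of_forall fun y hy => ?_))
  simpa [stableDensityCoeff_zero] using hC y (hx.trans hy)

/-- The summand of index `n` of `stableCdfPartialSum`, including the factor `1 / π`. -/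
noncomputable def stableCdfTerm (x α θ : ℝ) (n : ℕ) : ℝ :=
  1 / Real.pi * ((-1 : ℝ) ^ (n + 1) / (n.factorial : ℝ) * Real.Gamma (α * n) *
    Real.sin (Real.pi / 2 * α * n * (1 + θ)) * x ^ (-(α * n)))

lemma stableCdfPartialSum_eq_sum (N : ℕ) (x : ℝ) :
    stableCdfPartialSum N x α θ = ∑ n ∈ Finset.Ico 1 N, stableCdfTerm x α θ n := by
  simp only [stableCdfPartialSum, stableCdfTerm, Finset.mul_sum]

lemma integral_stableDensityCoeff_mul_rpow {x : ℝ} (hα : 0 < α) (hx : 0 < x) {n : ℕ} (hn : 1 ≤ n) :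
    ∫ y in Ioi x, stableDensityCoeff α θ n * y ^ (-(α * n + 1)) = stableCdfTerm x α θ n := by
  have hpos : 0 < α * n := mul_pos hα (by exact_mod_cast hn)
  rw [integral_const_mul, integral_rpow_neg_mul_add_one hα hx hn, stableDensityCoeff, stableCdfTerm,
    Real.Gamma_add_one hpos.ne']
  have := hpos.ne'
  field_simp

/-- The asymptotic expansion of the stable tail at `+∞`. -/
theorem exists_abs_stableTail_sub_le (hα : 0 < α) (h : |α * θ| < 1) {M : ℕ} (hM : 1 ≤ M) :
    ∃ C : ℝ, 0 ≤ C ∧ ∀ x : ℝ, 0 < x →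
      |stableTail x α θ - stableCdfPartialSum M x α θ| ≤ C * x ^ (-(α * M)) := by
  obtain ⟨C, hC, hb⟩ := exists_abs_stableDensity_sub_le hα h M
  have hpos : 0 < α * M := mul_pos hα (by exact_mod_cast hM)
  refine ⟨C / (α * M), by positivity, fun x hx => ?_⟩
  have hint : ∀ n ∈ Finset.Ico 1 M,
      IntegrableOn (fun y : ℝ => stableDensityCoeff α θ n * y ^ (-(α * n + 1))) (Ioi x) :=
    fun n hn => (integrableOn_rpow_neg_mul_add_one hα hx (Finset.mem_Ico.1 hn).1).const_mul _
  have hsum : stableCdfPartialSum M x α θ =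
      ∫ y in Ioi x, ∑ n ∈ Finset.Ico 1 M, stableDensityCoeff α θ n * y ^ (-(α * n + 1)) := by
    rw [integral_finsetSum _ hint, stableCdfPartialSum_eq_sum]
    exact Finset.sum_congr rfl fun n hn =>
      (integral_stableDensityCoeff_mul_rpow hα hx (Finset.mem_Ico.1 hn).1).symm
  rw [stableTail, hsum,
    ← integral_sub (integrableOn_stableDensity hα h hx) (integrable_finsetSum _ hint)]
  rw [← Real.norm_eq_abs]
  refine (norm_integral_le_of_norm_le (g := fun y => C * y ^ (-(α * M + 1)))
    ((integrableOn_rpow_neg_mul_add_one hα hx hM).const_mul C)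
    ((ae_restrict_iff' measurableSet_Ioi).2 (Eventually.of_forall fun y hy => ?_))).trans_eq ?_
  · have := hb y (hx.trans hy)
    rwa [Finset.range_eq_Ico, Finset.sum_eq_sum_Ico_succ_bot hM, stableDensityCoeff_zero,
      zero_mul, zero_add] at this
  · rw [integral_const_mul, integral_rpow_neg_mul_add_one hα hx hM]
    ring

lemma abs_stableCdfTerm_le {x : ℝ} (hα : 0 < α) (hx : 0 < x) (n : ℕ) :
    |stableCdfTerm x α θ n| ≤
      x ^ (-(α * n)) / (Real.pi * (n.factorial : ℝ)) * Real.Gamma (α * n) := by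
  have hG : 0 ≤ Real.Gamma (α * n) := Real.Gamma_nonneg_of_nonneg (by positivity)
  have hp : 0 ≤ x ^ (-(α * n)) := Real.rpow_nonneg hx.le _
  have hfac : |(-1 : ℝ) ^ (n + 1) / (n.factorial : ℝ)| = 1 / (n.factorial : ℝ) := by
    rw [abs_div, abs_neg_one_pow, Nat.abs_cast]
  rw [stableCdfTerm, abs_mul, abs_mul, abs_mul, abs_mul, hfac, abs_of_nonneg hG,
    abs_of_nonneg hp, abs_of_pos (by positivity : 0 < 1 / Real.pi)]
  calc _ ≤ 1 / Real.pi * (1 / (n.factorial : ℝ) * Real.Gamma (α * n) * 1 * x ^ (-(α * n))) := by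
        gcongr
        exact Real.abs_sin_le_one _
    _ = _ := by field_simp

/-- The remainder of the expansion of the tail is eventually bounded by its first two terms. -/
theorem eventually_abs_stableTail_sub_le (hα : 0 < α) (h : |α * θ| < 1) {N : ℕ} (hN : 1 ≤ N) :
    ∀ᶠ x : ℝ in atTop,
      |stableTail x α θ - stableCdfPartialSum N x α θ| ≤ stableCdfRemainderBound N x α := by
  obtain ⟨C, -, hb⟩ := exists_abs_stableTail_sub_le hα h (M := N + 2) (by omega)
  have hN' : (0 : ℝ) < N := by exact_mod_cast hN
  have hG : 0 < Real.Gamma (α * (N + 1)) := Real.Gamma_pos_of_pos (by positivity)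
  -- What remains of the second summand's coefficient after term `N + 1`, since `1/N! - 1/(N+1)! =
  -- (1/N!) · N/(N+1)`. It is positive because `N ≥ 1`, so eventually `C x^(-α) ≤ D`.
  set D := Real.Gamma (α * (N + 1)) / (Real.pi * N.factorial) * (N / (N + 1)) with hD
  have hDpos : 0 < D := by positivity
  have hlim : Tendsto (fun x : ℝ => C * x ^ (-α)) atTop (𝓝 0) := by
    simpa using (tendsto_rpow_neg_atTop hα).const_mul C
  filter_upwards [eventually_gt_atTop 0, hlim.eventually_le_const hDpos] with x hx hxD
  have hsplit : stableTail x α θ - stableCdfPartialSum N x α θ =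
      stableCdfTerm x α θ N + stableCdfTerm x α θ (N + 1) +
        (stableTail x α θ - stableCdfPartialSum (N + 2) x α θ) := by
    simp only [stableCdfPartialSum_eq_sum]
    rw [Finset.sum_Ico_succ_top (by omega), Finset.sum_Ico_succ_top hN]
    ring
  have h1 : x ^ (-(α * (N + 1 : ℕ))) = x ^ (-(α * N)) * x ^ (-α) := by
    rw [← Real.rpow_add hx]; push_cast; ring_nf
  have h2 : x ^ (-(α * (N + 2 : ℕ))) = x ^ (-(α * N)) * x ^ (-α) * x ^ (-α) := by
    rw [← Real.rpow_add hx, ← Real.rpow_add hx]; push_cast; ring_nf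
  have h3 := abs_stableCdfTerm_le (θ := θ) hα hx N
  have h4 := abs_stableCdfTerm_le (θ := θ) hα hx (N + 1)
  have h5 := hb x hx
  rw [h1] at h4
  rw [h2] at h5
  push_cast [Nat.factorial_succ] at h4
  have hp : 0 ≤ x ^ (-(α * N)) * x ^ (-α) := by positivity
  have h6 := mul_le_mul_of_nonneg_left hxD hp
  rw [hsplit]
  refine (abs_add_three _ _ _).trans ((add_le_add_three h3 h4 h5).trans ?_)
  have h7 : stableCdfRemainderBound N x α =
      x ^ (-(α * N)) / (Real.pi * N.factorial) * Real.Gamma (α * N) +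
      x ^ (-(α * N)) * x ^ (-α) / (Real.pi * ((N + 1) * N.factorial)) *
        Real.Gamma (α * (N + 1)) + x ^ (-(α * N)) * x ^ (-α) * D := by
    rw [stableCdfRemainderBound, hD]
    field_simp
    ring
  rw [h7]
  linarith

variable {μ : Measure ℝ}

lemma IsStandardStrictlyStable.cdf_sub_cdf (hμ : IsStandardStrictlyStable μ α θ) (hα : 0 < α)
    (h : |α * θ| < 1) {a b : ℝ} (hab : a ≤ b) :
    cdf μ b - cdf μ a = ∫ x in a..b, stableDensity x α θ := by
  have := hμ.isProbabilityMeasure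
  have hψ : charFun μ = fun t => stableCharFun t α θ := funext hμ.charFun_eq
  have hinv := measureReal_Ioc_eq_integral_inversionDensity μ
    (hψ ▸ integrableOn_stableCharFun hα h) hab
  rw [hψ] at hinv
  rw [cdf_eq_real, cdf_eq_real, ← measureReal_sdiff (Iic_subset_Iic.2 hab) measurableSet_Iic,
    Iic_sdiff_Iic, hinv]
  rfl

lemma IsStandardStrictlyStable.one_sub_cdf (hμ : IsStandardStrictlyStable μ α θ) (hα : 0 < α)
    (h : |α * θ| < 1) {x : ℝ} (hx : 0 < x) :
    1 - cdf μ x = stableTail x α θ := by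
  refine tendsto_nhds_unique ((tendsto_cdf_atTop μ).sub_const (cdf μ x))
    ((intervalIntegral_tendsto_integral_Ioi x (integrableOn_stableDensity hα h hx)
      tendsto_id).congr' ?_)
  filter_upwards [eventually_ge_atTop x] with b hb using (hμ.cdf_sub_cdf hα h hb).symm

/-- The reflection `y ↦ -y` carries the left tail to the right tail of the density with parameter
`-θ`. -/
lemma IsStandardStrictlyStable.cdf_neg (hμ : IsStandardStrictlyStable μ α θ) (hα : 0 < α)
    (h : |α * θ| < 1) {x : ℝ} (hx : 0 < x) :
    cdf μ (-x) = stableTail x α (-θ) := by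
  have hlim := ((tendsto_cdf_atBot μ).comp tendsto_neg_atTop_atBot).const_sub (cdf μ (-x))
  rw [sub_zero] at hlim
  refine tendsto_nhds_unique hlim ((intervalIntegral_tendsto_integral_Ioi x
    (integrableOn_stableDensity hα (by simpa using h) hx) tendsto_id).congr' ?_)
  filter_upwards [eventually_ge_atTop x] with b hb
  simp only [← stableDensity_neg, intervalIntegral.integral_comp_neg
    (fun y => stableDensity y α θ), Function.comp, id]
  exact (hμ.cdf_sub_cdf hα h (neg_le_neg hb)).symm

end StableTail

theorem theorem2 :
    ∃ R : ℕ → ℝ → ℝ → ℝ → ℝ,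
      ∀ α θ : ℝ, StableAdmissible α θ → θ ≠ 1 → θ ≠ -1 → ∀ N : ℕ, 1 ≤ N →
        (∀ μ : Measure ℝ, IsStandardStrictlyStable μ α θ → ∀ x : ℝ, x ≠ 0 →
          cdf μ x = 1 / 2 * (1 + Real.sign x) -
            Real.sign x * (stableCdfPartialSum N |x| α (θ * Real.sign x) +
              R N |x| α (θ * Real.sign x))) ∧
        (∀ᶠ x : ℝ in atTop, |R N x α θ| ≤ stableCdfRemainderBound N x α) := by
  -- With this choice the partial sum cancels, leaving the tail formulas for `cdf μ` on the two
  -- half-lines.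
  refine ⟨fun N x α θ => stableTail x α θ - stableCdfPartialSum N x α θ,
    fun α θ hadm h1 h2 N hN => ⟨fun μ hμ x hx => ?_,
      eventually_abs_stableTail_sub_le hadm.1 (hadm.abs_mul_lt_one h1 h2) hN⟩⟩
  have h := hadm.abs_mul_lt_one h1 h2
  simp only [add_sub_cancel]
  rcases lt_or_gt_of_ne hx with hx | hx
  · have := hμ.cdf_neg hadm.1 h (neg_pos.2 hx)
    rw [neg_neg] at this
    rw [this, Real.sign_of_neg hx, abs_of_neg hx, mul_neg_one]
    ring
  · rw [Real.sign_of_pos hx, abs_of_pos hx, mul_one, ← hμ.one_sub_cdf hadm.1 h hx]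
    ring
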